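/- Let $\pi_1,\pi_2>0$, $\pi_3\in(-\pi_2,\pi_2)$, $n\ge 1$, $p\in\{1\}\cup[2,\infty)$, $A>0$, $\alpha\in(0,1)$ be real parameters and $\alpha_c=1-\alpha$. Consider the nondimensionalized Bouc-Wen-Maxwell collision model, i.e. the autonomous system $\dot{\mathbf X}=f(\mathbf X)$ for $\mathbf X=(R,Y,Z,W)\in\mathbb R^4$ with $$\begin{aligned} f_1(\mathbf X)&=\alpha\pi_1|Y|^{p-1}Y+\alpha_c\pi_1|Z|^{p-1}Z,\\ f_2(\mathbf X)&=W,\\ f_3(\mathbf X)&=A\left(W-\pi_2|Z|^{n-1}Z|W|-\pi_3|Z|^nW\right),\\ f_4(\mathbf X)&=-\tfrac1{\pi_1}f_1(\mathbf X)-\alpha p\pi_1|Y|^{p-1}f_2(\mathbf X)-\alpha_c p\pi_1|Z|^{p-1}f_3(\mathbf X) \end{aligned}$$ (where $0^0=1$) and arbitrary initial states in $\mathbb R^4$. Put $Q(\mathbf X)=f_1(\mathbf X)+W$ and $$\mathcal V(\mathbf X)=\left(R+\pi_1Q(\mathbf X)\right)^2+\frac{Q(\mathbf X)^2}{2}+\frac{\alpha}{p+1}|Y|^{p+1}+\frac{\alpha_c}{(p+1)A}|Z|^{p+1},$$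 $\mathcal S_{\mathbf Y}=\{\mathbf X\in\mathbb R^4:\mathcal V(\mathbf X)\le\mathcal V(\mathbf Y)\}$ for $\mathbf Y\in\mathbb R^4$, and $$\mathcal E=\left\{\left(R,\,Y,\,-(\alpha/\alpha_c)^{1/p}\,Y,\,0\right):R,Y\in\mathbb R\right\}.$$ A set $U\subseteq\mathbb R^4$ is called invariant if (i) every solution $\mathbf X:[0,\infty)\to\mathbb R^4$ with $\mathbf X(0)\in U$ satisfies $\mathbf X(t)\in U$ for all $t\ge0$, and (ii) for every $z\in U$ and $T\ge0$ there is a solution $\mathbf X:[0,T]\to U$ with $\mathbf X(T)=z$. For $\mathbf Y\in\mathbb R^4$, the positive limit set $\mathcal O^{+\infty}_{\mathbf Y}$ is the set of all $q\in\mathbb R^4$ for which there is a nondecreasing sequence $(t_k)$ of positive reals with $t_k\to+\infty$ and $\mathbf X(t_k)\to q$, where $\mathbf X:[0,\infty)\to\mathbb R^4$ is the solution with $\mathbf X(0)=\mathbf Y$. Proposition. Let $\mathbf X:[0,\infty)\to\mathbb R^4$ be a solution of the model with $\mathbf X(0)=\mathbf Y$. Then $\mathcal O^{+\infty}_{\mathbf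 Y}$ is a nonempty, connected, invariant set; $\mathbf X(t)$ converges to $\mathcal O^{+\infty}_{\mathbf Y}$ as $t\to+\infty$, i.e. for every $\varepsilon>0$ there is $T>0$ such that $\inf_{q\in\mathcal O^{+\infty}_{\mathbf Y}}\lVert\mathbf X(t)-q\rVert_2<\varepsilon$ for all $t>T$; and $\mathcal O^{+\infty}_{\mathbf Y}\subseteq\mathcal S_{\mathbf Y}\cap\mathcal E$. -/

import Mathlib

namespace BoucWenMaxwell

/-! ### Autonomous systems `ẋ = f(x)` on `ℝⁿ` -/

section Systems

variable {d : ℕ}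

/-- `x` is a solution of `ẋ = f(x)` on the interval `I` (one-sided derivatives at endpoints of `I`;
values of `x` outside `I` are irrelevant). -/
def IsSolutionOn (f : EuclideanSpace ℝ (Fin d) → EuclideanSpace ℝ (Fin d)) (I : Set ℝ)
    (x : ℝ → EuclideanSpace ℝ (Fin d)) : Prop :=
  ∀ t ∈ I, HasDerivWithinAt x (f (x t)) I t

/-- Every forward solution that starts in `U` stays in `U`. -/
def IsPositivelyInvariant (f : EuclideanSpace ℝ (Fin d) → EuclideanSpace ℝ (Fin d))
    (U : Set (EuclideanSpace ℝ (Fin d))) : Prop :=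
  ∀ x : ℝ → EuclideanSpace ℝ (Fin d), IsSolutionOn f (Set.Ici 0) x → x 0 ∈ U →
    ∀ t, 0 ≤ t → x t ∈ U

/-- For every `z ∈ U` and `T ≥ 0` there is a solution `[0, T] → U` that ends at `z`. -/
def IsNegativelyInvariant (f : EuclideanSpace ℝ (Fin d) → EuclideanSpace ℝ (Fin d))
    (U : Set (EuclideanSpace ℝ (Fin d))) : Prop :=
  ∀ z ∈ U, ∀ T : ℝ, 0 ≤ T → ∃ x : ℝ → EuclideanSpace ℝ (Fin d),
    IsSolutionOn f (Set.Icc 0 T) x ∧ (∀ t ∈ Set.Icc 0 T, x t ∈ U) ∧ x T = z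

/-- Positively and negatively invariant. -/
def IsInvariant (f : EuclideanSpace ℝ (Fin d) → EuclideanSpace ℝ (Fin d))
    (U : Set (EuclideanSpace ℝ (Fin d))) : Prop :=
  IsPositivelyInvariant f U ∧ IsNegativelyInvariant f U

/-- The positive limit set of the initial state `z`: all limits of `x (t k)` along nondecreasing
sequences of positive times `t k → +∞`, where `x` is the forward solution with `x 0 = z`. -/
def positiveLimitSet (f : EuclideanSpace ℝ (Fin d) → EuclideanSpace ℝ (Fin d))
    (z : EuclideanSpace ℝ (Fin d)) : Set (EuclideanSpace ℝ (Fin d)) :=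
  {q | ∃ x : ℝ → EuclideanSpace ℝ (Fin d), IsSolutionOn f (Set.Ici 0) x ∧ x 0 = z ∧
    ∃ t : ℕ → ℝ, Monotone t ∧ (∀ k, 0 < t k) ∧ Filter.Tendsto t Filter.atTop Filter.atTop ∧
      Filter.Tendsto (fun k => x (t k)) Filter.atTop (nhds q)}

/-- `x(t)` converges to the set `S` as `t → +∞`: for every `ε > 0` there is `T > 0` such that the
Euclidean distance from `x(t)` to `S` is less than `ε` for all `t > T`. (The extended distance
makes this fail for empty `S`.) -/
def ConvergesToSet (x : ℝ → EuclideanSpace ℝ (Fin d)) (S : Set (EuclideanSpace ℝ (Fin d))) :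
    Prop :=
  ∀ ε : ℝ, 0 < ε → ∃ T : ℝ, 0 < T ∧ ∀ t, T < t → Metric.infEDist (x t) S < ENNReal.ofReal ε

end Systems

/-! ### The nondimensionalized Bouc-Wen-Maxwell collision model -/

/-- The dimensionless parameters `(π₁, π₂, π₃, n, p, α, A)`. -/
structure Params where
  pi1 : ℝ
  pi2 : ℝ
  pi3 : ℝ
  n : ℝ
  p : ℝ
  α : ℝ
  A : ℝ

/-- The standing assumptions on the parameters. -/
structure Params.Admissible (P : Params) : Prop where
  pi1_pos : 0 < P.pi1
  pi2_pos : 0 < P.pi2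
  pi3_mem : P.pi3 ∈ Set.Ioo (-P.pi2) P.pi2
  one_le_n : 1 ≤ P.n
  p_cond : 2 ≤ P.p ∨ P.p = 1
  α_mem : P.α ∈ Set.Ioo (0 : ℝ) 1
  A_pos : 0 < P.A

noncomputable section

/-- `α_c = 1 - α`. -/
def Params.αc (P : Params) : ℝ := 1 - P.α

/-- Right-hand side of the equation for `R`, at `(R, Y, Z, W) = (X 0, X 1, X 2, X 3)`. -/
def f₁ (P : Params) (X : EuclideanSpace ℝ (Fin 4)) : ℝ :=
  P.α * P.pi1 * |X 1| ^ (P.p - 1) * X 1 + P.αc * P.pi1 * |X 2| ^ (P.p - 1) * X 2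

/-- Right-hand side of the equation for `Y`. -/
def f₂ (X : EuclideanSpace ℝ (Fin 4)) : ℝ := X 3

/-- Right-hand side of the equation for `Z`. -/
def f₃ (P : Params) (X : EuclideanSpace ℝ (Fin 4)) : ℝ :=
  P.A * (X 3 - P.pi2 * |X 2| ^ (P.n - 1) * X 2 * |X 3| - P.pi3 * |X 2| ^ P.n * X 3)

/-- Right-hand side of the equation for `W`. For `p = 1` the factors `|·| ^ (p - 1)` are `1`,
also at `0`. -/
def f₄ (P : Params) (X : EuclideanSpace ℝ (Fin 4)) : ℝ :=
  -(1 / P.pi1) * f₁ P X - P.α * P.p * P.pi1 * |X 1| ^ (P.p - 1) * f₂ X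
    - P.αc * P.p * P.pi1 * |X 2| ^ (P.p - 1) * f₃ P X

/-- The state function of the model. -/
def stateFun (P : Params) (X : EuclideanSpace ℝ (Fin 4)) : EuclideanSpace ℝ (Fin 4) :=
  !₂[f₁ P X, f₂ X, f₃ P X, f₄ P X]

/-- The second output `Q = Ṙ + Ẏ` of the model. -/
def Q (P : Params) (X : EuclideanSpace ℝ (Fin 4)) : ℝ :=
  P.α * P.pi1 * |X 1| ^ (P.p - 1) * X 1 + P.αc * P.pi1 * |X 2| ^ (P.p - 1) * X 2 + X 3

/-- The Lyapunov function. -/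
def lyapunov (P : Params) (X : EuclideanSpace ℝ (Fin 4)) : ℝ :=
  (X 0 + P.pi1 * Q P X) ^ 2 + Q P X ^ 2 / 2 + P.α / (P.p + 1) * |X 1| ^ (P.p + 1)
    + P.αc / ((P.p + 1) * P.A) * |X 2| ^ (P.p + 1)

/-- The Lyapunov sublevel set of the state `X`. -/
def sublevel (P : Params) (X : EuclideanSpace ℝ (Fin 4)) : Set (EuclideanSpace ℝ (Fin 4)) :=
  {X' | lyapunov P X' ≤ lyapunov P X}

/-- The set `{(R, Y, -(α / α_c) ^ (1 / p) * Y, 0) : R, Y ∈ ℝ}`. -/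
def equilibria (P : Params) : Set (EuclideanSpace ℝ (Fin 4)) :=
  {X | ∃ r y : ℝ, X = !₂[r, y, -(P.α / P.αc) ^ (1 / P.p) * y, 0]}

end

end BoucWenMaxwell

open Set Filter Topology

namespace BoucWenMaxwell

/-! ### Positive limit sets of bounded trajectories -/

section LimitSets

variable {d : ℕ} {f : EuclideanSpace ℝ (Fin d) → EuclideanSpace ℝ (Fin d)}
  {x y : ℝ → EuclideanSpace ℝ (Fin d)} {K : Set (EuclideanSpace ℝ (Fin d))}

/-! The proof is LaSalle's invariance principle. The vector field is locally Lipschitz, so forward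
solutions are unique and depend continuously on their initial state. Along solutions `R + π₁Q` is
conserved, since `Q' = -f₁/π₁` and `R' = f₁`. Therefore `V' = -f₁²/π₁` minus a hysteresis term that
is nonnegative because `|π₃| < π₂`. Sublevel sets of `V` are compact (`isCompact_sublevel`), so the
trajectory is bounded. Its limit set is then a decreasing intersection of compact connected tails,
which yields nonemptiness, connectedness and attraction; invariance follows by passing to limits of
time-shifted solutions (`exists_limit_solution`). `V` is constant on the limit set, so each of its
points starts a solution with `V' = 0`, that is, `f₁ = 0` and `ZW = 0` at all times. Here `f₁ = 0`
ties `Z` to `Y`. If `W ≠ 0` initially, then `Z`, and with it `Y`, vanishes for a short time,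
contradicting `Y' = W` (`mem_equilibria_of_lyapunov_const`). -/

theorem IsSolutionOn.continuousOn {I : Set ℝ} (hx : IsSolutionOn f I x) : ContinuousOn x I :=
  fun t ht => (hx t ht).continuousWithinAt

theorem IsSolutionOn.mono {I J : Set ℝ} (hx : IsSolutionOn f I x) (h : J ⊆ I) :
    IsSolutionOn f J x :=
  fun t ht => (hx t (h ht)).mono h

/-- Time translates of forward solutions are forward solutions. -/
theorem IsSolutionOn.comp_add_left (hx : IsSolutionOn f (Ici 0) x) {τ : ℝ} (hτ : 0 ≤ τ) :
    IsSolutionOn f (Ici 0) (fun t => x (τ + t)) := by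
  intro t ht
  have h1 : HasDerivWithinAt (fun s : ℝ => τ + s) 1 (Ici 0) t :=
    ((hasDerivAt_id t).const_add τ).hasDerivWithinAt
  have h2 : MapsTo (fun s : ℝ => τ + s) (Ici 0) (Ici 0) := fun s hs => add_nonneg hτ hs
  simpa [Function.comp_def] using (hx (τ + t) (h2 ht)).scomp t h1 h2

theorem IsSolutionOn.hasDerivWithinAt_Ici (hx : IsSolutionOn f (Ici 0) x) {t : ℝ} (ht : 0 ≤ t) :
    HasDerivWithinAt x (f (x t)) (Ici t) t :=
  (hx t ht).mono (Ici_subset_Ici.2 ht)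

/-- Two solutions in a set where the vector field is Lipschitz separate at most exponentially. -/
theorem IsSolutionOn.dist_le {L : NNReal} (hf : LipschitzOnWith L f K)
    (hx : IsSolutionOn f (Ici 0) x) (hy : IsSolutionOn f (Ici 0) y) {T : ℝ} (hT : 0 ≤ T)
    (hxK : ∀ t ∈ Icc 0 T, x t ∈ K) (hyK : ∀ t ∈ Icc 0 T, y t ∈ K) :
    dist (x T) (y T) ≤ dist (x 0) (y 0) * Real.exp (L * T) := by
  have h := dist_le_of_trajectories_ODE_of_mem (v := fun _ => f) (s := fun _ => K) (K := L)
    (fun _ _ => hf) (hx.continuousOn.mono Icc_subset_Ici_self)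
    (fun t ht => hx.hasDerivWithinAt_Ici ht.1) (fun t ht => hxK t ⟨ht.1, ht.2.le⟩)
    (hy.continuousOn.mono Icc_subset_Ici_self)
    (fun t ht => hy.hasDerivWithinAt_Ici ht.1) (fun t ht => hyK t ⟨ht.1, ht.2.le⟩)
    le_rfl T ⟨hT, le_rfl⟩
  simpa using h

/-- Forward uniqueness for locally Lipschitz vector fields. -/
theorem IsSolutionOn.eq_of_eq_zero (hf : LocallyLipschitz f)
    (hx : IsSolutionOn f (Ici 0) x) (hy : IsSolutionOn f (Ici 0) y) (h0 : x 0 = y 0)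
    {t : ℝ} (ht : 0 ≤ t) : x t = y t := by
  -- Both arcs up to time `t` form one compact set, on which a single Lipschitz constant is
  -- available.
  have hK : IsCompact (x '' Icc 0 t ∪ y '' Icc 0 t) :=
    (isCompact_Icc.image_of_continuousOn (hx.continuousOn.mono Icc_subset_Ici_self)).union
      (isCompact_Icc.image_of_continuousOn (hy.continuousOn.mono Icc_subset_Ici_self))
  obtain ⟨L, hL⟩ := hf.locallyLipschitzOn.exists_lipschitzOnWith_of_compact hK
  have h := hx.dist_le hL hy ht (fun s hs => Or.inl ⟨s, hs, rfl⟩) (fun s hs => Or.inr ⟨s, hs, rfl⟩)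
  rw [h0, dist_self, zero_mul] at h
  exact dist_le_zero.1 h

theorem IsSolutionOn.integral_eq_sub (hf : Continuous f) (hx : IsSolutionOn f (Ici 0) x)
    {t : ℝ} (ht : 0 ≤ t) : ∫ s in (0 : ℝ)..t, f (x s) = x t - x 0 := by
  refine intervalIntegral.integral_eq_sub_of_hasDeriv_right_of_le ht
    (hx.continuousOn.mono Icc_subset_Ici_self)
    (fun s hs => (hx.hasDerivWithinAt_Ici hs.1.le).mono Ioi_subset_Ici_self) ?_
  refine ContinuousOn.intervalIntegrable ?_
  rw [uIcc_of_le ht]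
  exact hf.comp_continuousOn (hx.continuousOn.mono Icc_subset_Ici_self)

/-- The integral form of the equation is the one that survives pointwise limits of solutions. -/
theorem isSolutionOn_of_integral_eq (hf : Continuous f) (hx : Continuous x)
    (h : ∀ t, 0 ≤ t → ∫ s in (0 : ℝ)..t, f (x s) = x t - x 0) : IsSolutionOn f (Ici 0) x := by
  intro t ht
  have h1 : HasDerivAt (fun t => x 0 + ∫ s in (0 : ℝ)..t, f (x s)) (f (x t)) t :=
    ((hf.comp hx).integral_hasStrictDerivAt 0 t).hasDerivAt.const_add _
  refine h1.hasDerivWithinAt.congr (fun s hs => ?_) ?_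
  · rw [h s hs]; abel
  · rw [h t ht]; abel

theorem IsSolutionOn.dist_le_mul (hx : IsSolutionOn f (Ici 0) x) {C : ℝ}
    (hC : ∀ t, 0 ≤ t → ‖f (x t)‖ ≤ C) {s t : ℝ} (hs : 0 ≤ s) (ht : 0 ≤ t) :
    dist (x s) (x t) ≤ C * dist s t := by
  simpa [dist_eq_norm] using
    (convex_Ici (0 : ℝ)).norm_image_sub_le_of_norm_hasDerivWithin_le hx hC ht hs

/-- If the initial states of solutions in a compact set converge, the solutions converge pointwise
to a solution. -/
theorem exists_limit_solution (hf : LocallyLipschitz f) (hK : IsCompact K)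
    {u : ℕ → ℝ → EuclideanSpace ℝ (Fin d)} (hu : ∀ k, IsSolutionOn f (Ici 0) (u k))
    (huK : ∀ k t, 0 ≤ t → u k t ∈ K) {q : EuclideanSpace ℝ (Fin d)}
    (hq : Tendsto (fun k => u k 0) atTop (𝓝 q)) :
    ∃ x, IsSolutionOn f (Ici 0) x ∧ x 0 = q ∧
      ∀ t, 0 ≤ t → Tendsto (fun k => u k t) atTop (𝓝 (x t)) := by
  obtain ⟨L, hL⟩ := hf.locallyLipschitzOn.exists_lipschitzOnWith_of_compact hK
  obtain ⟨C, hC⟩ := hK.exists_bound_of_continuousOn hf.continuous.continuousOn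
  -- Freezing negative times at `0` makes the limit function continuous on all of `ℝ`, as
  -- `isSolutionOn_of_integral_eq` requires.
  have hlim : ∀ t : ℝ, ∃ z, Tendsto (fun k => u k (max t 0)) atTop (𝓝 z) := by
    intro t
    refine cauchySeq_tendsto_of_complete (Metric.cauchySeq_iff'.2 fun ε hε => ?_)
    have he := Real.exp_pos (L * max t 0)
    obtain ⟨N, hN⟩ := Metric.cauchySeq_iff'.1 hq.cauchySeq (ε / Real.exp (L * max t 0))
      (div_pos hε he)
    refine ⟨N, fun k hk => ?_⟩
    refine ((hu k).dist_le hL (hu N) (le_max_right t 0) (fun s hs => huK k s hs.1)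
      (fun s hs => huK N s hs.1)).trans_lt ?_
    exact (lt_div_iff₀ he).1 (hN k hk)
  choose x hx using hlim
  have hx' : ∀ t, 0 ≤ t → Tendsto (fun k => u k t) atTop (𝓝 (x t)) := fun t ht => by
    simpa [max_eq_left ht] using hx t
  have hx0 : x 0 = q := tendsto_nhds_unique (hx' 0 le_rfl) hq
  have hC' : ∀ k t, 0 ≤ t → ‖f (u k t)‖ ≤ C := fun k t ht => hC _ (huK k t ht)
  have hC0 : 0 ≤ C := (norm_nonneg _).trans (hC' 0 0 le_rfl)
  have hxc : Continuous x := by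
    refine (LipschitzWith.of_dist_le_mul (K := ⟨C, hC0⟩) fun s t => ?_).continuous
    refine le_of_tendsto ((hx s).dist (hx t)) (Eventually.of_forall fun k => ?_)
    refine ((hu k).dist_le_mul (hC' k) (le_max_right s 0) (le_max_right t 0)).trans ?_
    refine mul_le_mul_of_nonneg_left ?_ hC0
    simpa [Real.dist_eq] using abs_max_sub_max_le_abs s t 0
  refine ⟨x, isSolutionOn_of_integral_eq hf.continuous hxc fun t ht => ?_, hx0, hx'⟩
  refine tendsto_nhds_unique ?_ ((hx' t ht).sub (hx' 0 le_rfl))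
  have hcongr : ∀ k, ∫ s in (0 : ℝ)..t, f (u k s) = u k t - u k 0 :=
    fun k => (hu k).integral_eq_sub hf.continuous ht
  simp only [← hcongr]
  refine intervalIntegral.tendsto_integral_filter_of_dominated_convergence (fun _ => C)
    (Eventually.of_forall fun k => ?_) (Eventually.of_forall fun k => ?_)
    intervalIntegrable_const (Eventually.of_forall fun s hs => ?_)
  · rw [uIoc_of_le ht]
    exact ((hf.continuous.comp_continuousOn (hu k).continuousOn).mono
      fun s hs => hs.1.le).aestronglyMeasurable measurableSet_Ioc
  · refine Eventually.of_forall fun s hs => ?_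
    rw [uIoc_of_le ht] at hs
    exact hC' k s hs.1.le
  · rw [uIoc_of_le ht] at hs
    exact (hf.continuous.tendsto _).comp (hx' s hs.1.le)

/-- Membership in the positive limit set in terms of a given solution, along arbitrary sequences
of times tending to infinity. -/
theorem mem_positiveLimitSet_iff (hf : LocallyLipschitz f) (hx : IsSolutionOn f (Ici 0) x)
    {q : EuclideanSpace ℝ (Fin d)} :
    q ∈ positiveLimitSet f (x 0) ↔ ∃ t : ℕ → ℝ, (∀ k, 0 ≤ t k) ∧ Tendsto t atTop atTop ∧
      Tendsto (fun k => x (t k)) atTop (𝓝 q) := by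
  constructor
  · rintro ⟨y, hy, hy0, t, -, ht0, ht, hq⟩
    refine ⟨t, fun k => (ht0 k).le, ht, hq.congr fun k => ?_⟩
    exact hy.eq_of_eq_zero hf hx hy0 (ht0 k).le
  · rintro ⟨t, -, ht, hq⟩
    -- A strictly increasing subsequence of the times, with its first `N` terms dropped, is both
    -- monotone and positive.
    obtain ⟨φ, hφ, hmono⟩ := strictMono_subseq_of_tendsto_atTop ht
    obtain ⟨N, hN⟩ := eventually_atTop.1
      ((ht.comp hφ.tendsto_atTop).eventually (eventually_gt_atTop (0 : ℝ)))
    have hs : Tendsto (fun k => φ (k + N)) atTop atTop :=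
      hφ.tendsto_atTop.comp (tendsto_add_atTop_nat N)
    exact ⟨x, hx, rfl, fun k => t (φ (k + N)),
      fun i j hij => hmono.monotone (Nat.add_le_add_right hij N),
      fun k => hN _ (Nat.le_add_left N k), ht.comp hs, hq.comp hs⟩

/-- For a bounded trajectory this is a decreasing intersection of compact connected sets, so
compactness arguments apply to it. -/
theorem positiveLimitSet_eq_iInter (hf : LocallyLipschitz f) (hx : IsSolutionOn f (Ici 0) x) :
    positiveLimitSet f (x 0) = ⋂ k : ℕ, closure (x '' Ici (k : ℝ)) := by
  ext q
  rw [mem_positiveLimitSet_iff hf hx, mem_iInter]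
  constructor
  · rintro ⟨t, -, ht, hq⟩ k
    refine mem_closure_of_tendsto hq ?_
    filter_upwards [ht.eventually (eventually_ge_atTop (k : ℝ))] with i hi
    exact ⟨t i, hi, rfl⟩
  · intro h
    have h' : ∀ k : ℕ, ∃ t : ℝ, (k : ℝ) ≤ t ∧ dist (x t) q < 1 / ((k : ℝ) + 1) := by
      intro k
      obtain ⟨_, ⟨t, ht, rfl⟩, hd⟩ := Metric.mem_closure_iff.1 (h k) _ Nat.one_div_pos_of_nat
      exact ⟨t, ht, by rwa [dist_comm]⟩
    choose t ht hd using h'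
    refine ⟨t, fun k => (Nat.cast_nonneg k).trans (ht k),
      tendsto_atTop_mono ht tendsto_natCast_atTop_atTop, ?_⟩
    rw [tendsto_iff_dist_tendsto_zero]
    exact squeeze_zero (fun _ => dist_nonneg) (fun k => (hd k).le)
      tendsto_one_div_add_atTop_nhds_zero_nat

/-- A directed intersection of compact connected sets is connected. -/
theorem isConnected_iInter_of_directed {α ι : Type*} [TopologicalSpace α] [T2Space α]
    [Nonempty ι] {V : ι → Set α} (hV : Directed (· ⊇ ·) V) (hc : ∀ i, IsCompact (V i))
    (hconn : ∀ i, IsConnected (V i)) : IsConnected (⋂ i, V i) := by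
  have hclosed : ∀ i, IsClosed (V i) := fun i => (hc i).isClosed
  have hcI : IsCompact (⋂ i, V i) :=
    (hc (Classical.arbitrary ι)).of_isClosed_subset (isClosed_iInter hclosed) (iInter_subset _ _)
  refine ⟨IsCompact.nonempty_iInter_of_directed_nonempty_isCompact_isClosed V hV
    (fun i => (hconn i).nonempty) hc hclosed, ?_⟩
  rw [isPreconnected_closed_iff]
  intro A B hA hB hAB hAn hBn
  by_contra hne
  have hdisj : Disjoint ((⋂ i, V i) ∩ A) ((⋂ i, V i) ∩ B) := by
    rw [Set.disjoint_left]
    exact fun z hz hz' => hne ⟨z, hz.1, hz.2, hz'.2⟩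
  -- The two compact halves have disjoint open neighbourhoods; by compactness some `V i` already
  -- lies in their union, which contradicts its connectedness.
  obtain ⟨U, W, hU, hW, hAU, hBW, hUW⟩ :=
    SeparatedNhds.of_isCompact_isCompact (hcI.inter_right hA) (hcI.inter_right hB) hdisj
  obtain ⟨i, hi⟩ := exists_subset_nhds_of_isCompact hV hc (U := U ∪ W) fun z hz =>
    (hU.union hW).mem_nhds <| (hAB hz).imp (fun h => hAU ⟨hz, h⟩) (fun h => hBW ⟨hz, h⟩)
  have hsub := iInter_subset V i
  obtain ⟨z, -, hzU, hzW⟩ := (hconn i).isPreconnected U W hU hW hi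
    (hAn.imp fun z hz => ⟨hsub hz.1, hAU hz⟩) (hBn.imp fun z hz => ⟨hsub hz.1, hBW hz⟩)
  exact Set.disjoint_left.1 hUW hzU hzW

theorem directed_closure_tails (x : ℝ → EuclideanSpace ℝ (Fin d)) :
    Directed (· ⊇ ·) (fun k : ℕ => closure (x '' Ici (k : ℝ))) :=
  Antitone.directed_ge fun _ _ hij =>
    closure_mono (image_mono (Ici_subset_Ici.2 (Nat.cast_le.2 hij)))

theorem closure_tail_subset (hK : IsCompact K) (hxK : ∀ t, 0 ≤ t → x t ∈ K) (k : ℕ) :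
    closure (x '' Ici (k : ℝ)) ⊆ K :=
  closure_minimal (image_subset_iff.2 fun t ht => hxK t ((Nat.cast_nonneg k).trans ht))
    hK.isClosed

theorem isCompact_closure_tail (hK : IsCompact K) (hxK : ∀ t, 0 ≤ t → x t ∈ K) (k : ℕ) :
    IsCompact (closure (x '' Ici (k : ℝ))) :=
  hK.of_isClosed_subset isClosed_closure (closure_tail_subset hK hxK k)

theorem isConnected_positiveLimitSet (hf : LocallyLipschitz f) (hx : IsSolutionOn f (Ici 0) x)
    (hK : IsCompact K) (hxK : ∀ t, 0 ≤ t → x t ∈ K) :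
    IsConnected (positiveLimitSet f (x 0)) := by
  rw [positiveLimitSet_eq_iInter hf hx]
  refine isConnected_iInter_of_directed (directed_closure_tails x)
    (isCompact_closure_tail hK hxK) fun k => IsConnected.closure ?_
  exact isConnected_Ici.image x
    (hx.continuousOn.mono (Ici_subset_Ici.2 (Nat.cast_nonneg k)))

theorem convergesToSet_positiveLimitSet (hf : LocallyLipschitz f)
    (hx : IsSolutionOn f (Ici 0) x) (hK : IsCompact K) (hxK : ∀ t, 0 ≤ t → x t ∈ K) :
    ConvergesToSet x (positiveLimitSet f (x 0)) := by
  intro ε hε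
  rw [positiveLimitSet_eq_iInter hf hx]
  obtain ⟨k, hk⟩ := exists_subset_nhds_of_isCompact (directed_closure_tails x)
    (isCompact_closure_tail hK hxK)
    (U := Metric.thickening ε (⋂ k : ℕ, closure (x '' Ici (k : ℝ))))
    fun z hz => Metric.isOpen_thickening.mem_nhds (Metric.self_subset_thickening hε _ hz)
  refine ⟨k + 1, by positivity, fun t ht => hk (subset_closure ⟨t, ?_, rfl⟩)⟩
  exact ((lt_add_one _).trans ht).le

/-- Through every point of the positive limit set there is a forward solution in that set. -/
theorem exists_solution_in_positiveLimitSet (hf : LocallyLipschitz f)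
    (hx : IsSolutionOn f (Ici 0) x) (hK : IsCompact K) (hxK : ∀ t, 0 ≤ t → x t ∈ K)
    {q : EuclideanSpace ℝ (Fin d)} {τ : ℕ → ℝ} (hτ : ∀ k, 0 ≤ τ k)
    (hτ' : Tendsto τ atTop atTop) (hq : Tendsto (fun k => x (τ k)) atTop (𝓝 q)) :
    ∃ y, IsSolutionOn f (Ici 0) y ∧ y 0 = q ∧
      (∀ t, 0 ≤ t → Tendsto (fun k => x (τ k + t)) atTop (𝓝 (y t))) ∧
      ∀ t, 0 ≤ t → y t ∈ positiveLimitSet f (x 0) := by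
  obtain ⟨y, hy, hy0, hlim⟩ := exists_limit_solution hf hK
    (u := fun k t => x (τ k + t)) (fun k => hx.comp_add_left (hτ k))
    (fun k t ht => hxK _ (add_nonneg (hτ k) ht)) (q := q) (by simpa using hq)
  exact ⟨y, hy, hy0, hlim, fun t ht => (mem_positiveLimitSet_iff hf hx).2
    ⟨fun k => τ k + t, fun k => add_nonneg (hτ k) ht, tendsto_atTop_add_const_right _ t hτ',
      hlim t ht⟩⟩

theorem isInvariant_positiveLimitSet (hf : LocallyLipschitz f)
    (hx : IsSolutionOn f (Ici 0) x) (hK : IsCompact K) (hxK : ∀ t, 0 ≤ t → x t ∈ K) :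
    IsInvariant f (positiveLimitSet f (x 0)) := by
  constructor
  · intro y hy hy0 t ht
    obtain ⟨τ, hτ, hτ', hq⟩ := (mem_positiveLimitSet_iff hf hx).1 hy0
    obtain ⟨z, hz, hz0, -, hmem⟩ := exists_solution_in_positiveLimitSet hf hx hK hxK hτ hτ' hq
    rw [hy.eq_of_eq_zero hf hz hz0.symm ht]
    exact hmem t ht
  · intro q hq T hT
    obtain ⟨τ, -, hτ', hq⟩ := (mem_positiveLimitSet_iff hf hx).1 hq
    obtain ⟨N, hN⟩ := eventually_atTop.1 (hτ'.eventually (eventually_ge_atTop T))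
    -- For negative invariance, look at the trajectory `T` time units before it approaches `q`. A
    -- limit point `q'` of these states starts a solution in the limit set that reaches `q` at time
    -- `T`.
    have hσ : ∀ k, 0 ≤ τ (k + N) - T := fun k => sub_nonneg.2 (hN _ (Nat.le_add_left N k))
    obtain ⟨q', -, φ, hφ, hq'⟩ := hK.tendsto_subseq fun k => hxK _ (hσ k)
    have hs : Tendsto (fun k => φ k + N) atTop atTop :=
      (tendsto_add_atTop_nat N).comp hφ.tendsto_atTop
    obtain ⟨y, hy, -, hlim, hmem⟩ := exists_solution_in_positiveLimitSet hf hx hK hxK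
      (τ := fun k => τ (φ k + N) - T) (fun k => hσ (φ k))
      (tendsto_atTop_add_const_right _ (-T) (hτ'.comp hs)) hq'
    refine ⟨y, hy.mono Icc_subset_Ici_self, fun t ht => hmem t ht.1, ?_⟩
    refine tendsto_nhds_unique (hlim T hT) ?_
    simpa [Function.comp_def] using hq.comp hs

/-- LaSalle's principle: if `V` is continuous and nonincreasing along the bounded solution
`x`, then every point of the positive limit set starts a forward solution along which `V` is constant. -/
theorem exists_solution_lyapunov_const (hf : LocallyLipschitz f)
    (hx : IsSolutionOn f (Ici 0) x) (hK : IsCompact K) (hxK : ∀ t, 0 ≤ t → x t ∈ K)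
    {V : EuclideanSpace ℝ (Fin d) → ℝ} (hV : Continuous V)
    (hanti : AntitoneOn (fun t => V (x t)) (Ici 0)) {q : EuclideanSpace ℝ (Fin d)}
    (hq : q ∈ positiveLimitSet f (x 0)) :
    ∃ y, IsSolutionOn f (Ici 0) y ∧ y 0 = q ∧ ∀ t, 0 ≤ t → V (y t) = V q := by
  obtain ⟨τ, hτ, hτ', hlimq⟩ := (mem_positiveLimitSet_iff hf hx).1 hq
  obtain ⟨y, hy, hy0, -, hmem⟩ := exists_solution_in_positiveLimitSet hf hx hK hxK hτ hτ' hlimq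
  -- Each value of `V` along a sequence tending to `b` dominates all later values along the sequence
  -- tending to `a`. By symmetry `V` is constant on the limit set.
  have hle : ∀ a ∈ positiveLimitSet f (x 0), ∀ b ∈ positiveLimitSet f (x 0), V a ≤ V b := by
    intro a ha b hb
    obtain ⟨s, hs, hs', ha⟩ := (mem_positiveLimitSet_iff hf hx).1 ha
    obtain ⟨r, hr, -, hb⟩ := (mem_positiveLimitSet_iff hf hx).1 hb
    refine ge_of_tendsto ((hV.tendsto b).comp hb) (Eventually.of_forall fun k => ?_)
    refine le_of_tendsto ((hV.tendsto a).comp ha) ?_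
    filter_upwards [hs'.eventually (eventually_ge_atTop (r k))] with j hj
    exact hanti (hr k) (hs j) hj
  exact ⟨y, hy, hy0, fun t ht => le_antisymm (hle _ (hmem t ht) _ hq) (hle _ hq _ (hmem t ht))⟩

end LimitSets

/-! ### Signed powers -/

section SignedPowers

theorem locallyLipschitz_abs_rpow {a : ℝ} (ha : 1 ≤ a) :
    LocallyLipschitz fun x : ℝ => |x| ^ a := by
  have h : ContDiff ℝ 1 fun x : ℝ => x ^ a :=
    Real.contDiff_rpow_const_of_le (n := 1) (by simpa using ha)
  exact h.locallyLipschitz.comp lipschitzWith_one_norm.locallyLipschitz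

theorem abs_rpow_mul_abs {a : ℝ} (ha : 1 ≤ a) (x : ℝ) : |x| ^ (a - 1) * |x| = |x| ^ a := by
  rcases eq_or_ne x 0 with rfl | hx
  · simp [Real.zero_rpow (by linarith : a ≠ 0)]
  · rw [← Real.rpow_add_one (abs_ne_zero.2 hx), sub_add_cancel]

theorem abs_rpow_mul_self_of_nonneg {a : ℝ} (ha : 1 ≤ a) {x : ℝ} (hx : 0 ≤ x) :
    |x| ^ (a - 1) * x = x ^ a := by
  have := abs_rpow_mul_abs ha x
  rwa [abs_of_nonneg hx] at this ⊢

theorem abs_rpow_mul_self_neg (a x : ℝ) : |(-x)| ^ (a - 1) * (-x) = -(|x| ^ (a - 1) * x) := by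
  rw [abs_neg]; ring

theorem abs_rpow_mul_self_of_nonpos {a : ℝ} (ha : 1 ≤ a) {x : ℝ} (hx : x ≤ 0) :
    |x| ^ (a - 1) * x = -(-x) ^ a := by
  rw [← abs_rpow_mul_self_of_nonneg ha (neg_nonneg.2 hx), abs_rpow_mul_self_neg, neg_neg]

/-- For `1 < a < 2` the factor `|x| ^ (a - 1)` alone is not Lipschitz at `0`. The product is, being
a difference of `a`-th powers of the positive and negative parts. -/
theorem locallyLipschitz_abs_rpow_mul_self {a : ℝ} (ha : 1 ≤ a) :
    LocallyLipschitz fun x : ℝ => |x| ^ (a - 1) * x := by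
  have h : LocallyLipschitz fun x : ℝ => x ^ a :=
    (Real.contDiff_rpow_const_of_le (n := 1) (by simpa using ha)).locallyLipschitz
  have h0 : (0 : ℝ) ^ a = 0 := Real.zero_rpow (by linarith)
  have hmax : LipschitzWith 1 fun x : ℝ => max x 0 := LipschitzWith.id.max_const 0
  have hmax' : LipschitzWith 1 fun x : ℝ => max (-x) 0 := LipschitzWith.id.neg.max_const 0
  have key : (fun x : ℝ => |x| ^ (a - 1) * x) = fun x => (max x 0) ^ a - (max (-x) 0) ^ a := by
    funext x
    rcases le_total 0 x with hx | hx
    · rw [abs_rpow_mul_self_of_nonneg ha hx, max_eq_left hx, max_eq_right (by linarith), h0,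
        sub_zero]
    · rw [abs_rpow_mul_self_of_nonpos ha hx, max_eq_right hx, max_eq_left (by linarith), h0,
        zero_sub]
  rw [key]
  exact (h.comp hmax.locallyLipschitz).sub (h.comp hmax'.locallyLipschitz)

theorem hasDerivAt_abs_rpow_mul_self {p : ℝ} (hp : 1 ≤ p) (x : ℝ) :
    HasDerivAt (fun x : ℝ => |x| ^ (p - 1) * x) (p * |x| ^ (p - 1)) x := by
  have hpos : ∀ z : ℝ, 0 < z →
      HasDerivAt (fun x : ℝ => |x| ^ (p - 1) * x) (p * |z| ^ (p - 1)) z := by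
    intro z hz
    rw [abs_of_pos hz]
    refine (Real.hasDerivAt_rpow_const (Or.inr hp)).congr_of_eventuallyEq ?_
    filter_upwards [lt_mem_nhds hz] with y hy
    exact abs_rpow_mul_self_of_nonneg hp hy.le
  rcases lt_trichotomy x 0 with hx | rfl | hx
  · have h := ((hpos (-x) (neg_pos.2 hx)).comp x (hasDerivAt_neg x)).neg
    refine (h.congr_of_eventuallyEq (Eventually.of_forall fun y => ?_)).congr_deriv ?_
    · simp
    · simp
  -- At the origin the slope is `|t| ^ (p - 1)`: it tends to `0` if `p > 1`, and equals `1` if `p =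
  -- 1` because `0 ^ 0 = 1`.
  · rcases hp.eq_or_lt with rfl | hp
    · simpa using hasDerivAt_id' (0 : ℝ)
    · have h0 : (0 : ℝ) ^ (p - 1) = 0 := Real.zero_rpow (by linarith)
      rw [hasDerivAt_iff_tendsto_slope_zero]
      have hc : Continuous fun t : ℝ => |t| ^ (p - 1) :=
        continuous_abs.rpow_const fun _ => Or.inr (by linarith)
      have ht : Tendsto (fun t : ℝ => |t| ^ (p - 1)) (𝓝[≠] 0) (𝓝 (p * |(0 : ℝ)| ^ (p - 1))) := by
        have := hc.tendsto 0
        simp only [abs_zero, h0, mul_zero] at this ⊢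
        exact this.mono_left nhdsWithin_le_nhds
      refine ht.congr' ?_
      filter_upwards [self_mem_nhdsWithin] with t ht
      have ht : t ≠ 0 := ht
      simp
      field_simp
  · exact hpos x hx

/-- Turns a bound on a power into a bound on the variable without extracting roots. -/
theorem abs_le_one_add_abs_rpow {a : ℝ} (ha : 1 ≤ a) (x : ℝ) : |x| ≤ 1 + |x| ^ a := by
  rcases le_total |x| 1 with h | h
  · linarith [Real.rpow_nonneg (abs_nonneg x) a]
  · have := Real.rpow_le_rpow_of_exponent_le h ha
    rw [Real.rpow_one] at this
    linarith

theorem abs_abs_rpow_mul_self {a : ℝ} (ha : 1 ≤ a) (x : ℝ) : |(|x| ^ (a - 1) * x)| = |x| ^ a := by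
  rw [abs_mul, abs_of_nonneg (Real.rpow_nonneg (abs_nonneg x) _), abs_rpow_mul_abs ha]

theorem abs_rpow_mul_self_injective {a : ℝ} (ha : 1 ≤ a) :
    Function.Injective fun x : ℝ => |x| ^ (a - 1) * x := by
  have ha0 : a ≠ 0 := by linarith
  intro x y h
  have h : |x| ^ (a - 1) * x = |y| ^ (a - 1) * y := h
  have habs : |x| = |y| := by
    have := congrArg abs h
    rw [abs_abs_rpow_mul_self ha, abs_abs_rpow_mul_self ha] at this
    exact (Real.rpow_left_inj (abs_nonneg x) (abs_nonneg y) ha0).1 this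
  rcases eq_or_ne y 0 with rfl | hy
  · simpa using habs
  · rw [habs] at h
    exact mul_left_cancel₀ (Real.rpow_pos_of_pos (abs_pos.2 hy) _).ne' h

end SignedPowers

/-! ### The collision model -/

section Model

variable {P : Params}

theorem Params.Admissible.one_le_p (hP : P.Admissible) : 1 ≤ P.p := by
  rcases hP.p_cond with h | h <;> linarith

theorem Params.Admissible.αc_pos (hP : P.Admissible) : 0 < P.αc :=
  sub_pos.2 hP.α_mem.2

/-! ### Local Lipschitz continuity of the vector field. -/

theorem locallyLipschitz_mul {E : Type*} [PseudoEMetricSpace E] {g h : E → ℝ}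
    (hg : LocallyLipschitz g) (hh : LocallyLipschitz h) :
    LocallyLipschitz fun x => g x * h x :=
  (contDiff_mul (𝕜 := ℝ) (n := 1)).locallyLipschitz.comp (hg.prodMk hh)

theorem locallyLipschitz_coord (i : Fin 4) :
    LocallyLipschitz fun X : EuclideanSpace ℝ (Fin 4) => X i :=
  (EuclideanSpace.proj (𝕜 := ℝ) i).lipschitz.locallyLipschitz

/-- This is where `1 < p < 2` must be excluded: for such `p` the function has infinite slope at `0`.
-/
theorem Params.Admissible.locallyLipschitz_stiffness (hP : P.Admissible) :
    LocallyLipschitz fun x : ℝ => |x| ^ (P.p - 1) := by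
  rcases hP.p_cond with h | h
  · exact locallyLipschitz_abs_rpow (by linarith)
  · simpa [h] using LocallyLipschitz.const (α := ℝ) (1 : ℝ)

theorem locallyLipschitz_f₁ (hP : P.Admissible) : LocallyLipschitz (f₁ P) := by
  have h := locallyLipschitz_abs_rpow_mul_self hP.one_le_p
  have h1 := locallyLipschitz_mul (LocallyLipschitz.const (P.α * P.pi1))
    (h.comp (locallyLipschitz_coord 1))
  have h2 := locallyLipschitz_mul (LocallyLipschitz.const (P.αc * P.pi1))
    (h.comp (locallyLipschitz_coord 2))
  have e : f₁ P = fun X => P.α * P.pi1 * (|X 1| ^ (P.p - 1) * X 1)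
      + P.αc * P.pi1 * (|X 2| ^ (P.p - 1) * X 2) := by
    funext X
    simp only [f₁, mul_assoc]
  rw [e]
  exact h1.add h2

theorem locallyLipschitz_f₃ (hP : P.Admissible) : LocallyLipschitz (f₃ P) := by
  have hW := locallyLipschitz_coord 3
  have hWabs : LocallyLipschitz fun X : EuclideanSpace ℝ (Fin 4) => |X 3| :=
    lipschitzWith_one_norm.locallyLipschitz.comp hW
  have h1 := locallyLipschitz_mul (LocallyLipschitz.const P.pi2) (locallyLipschitz_mul
    ((locallyLipschitz_abs_rpow_mul_self hP.one_le_n).comp (locallyLipschitz_coord 2)) hWabs)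
  have h2 := locallyLipschitz_mul (LocallyLipschitz.const P.pi3) (locallyLipschitz_mul
    ((locallyLipschitz_abs_rpow hP.one_le_n).comp (locallyLipschitz_coord 2)) hW)
  convert locallyLipschitz_mul (LocallyLipschitz.const P.A) ((hW.sub h1).sub h2) using 1
  funext X
  simp only [f₃, Function.comp_apply, mul_assoc]

theorem locallyLipschitz_f₄ (hP : P.Admissible) : LocallyLipschitz (f₄ P) := by
  have hs := hP.locallyLipschitz_stiffness
  have h1 := locallyLipschitz_mul (LocallyLipschitz.const (-(1 / P.pi1))) (locallyLipschitz_f₁ hP)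
  have h2 := locallyLipschitz_mul (LocallyLipschitz.const (P.α * P.p * P.pi1))
    (locallyLipschitz_mul (hs.comp (locallyLipschitz_coord 1)) (locallyLipschitz_coord 3))
  have h3 := locallyLipschitz_mul (LocallyLipschitz.const (P.αc * P.p * P.pi1))
    (locallyLipschitz_mul (hs.comp (locallyLipschitz_coord 2)) (locallyLipschitz_f₃ hP))
  have e : f₄ P = fun X => -(1 / P.pi1) * f₁ P X
      - P.α * P.p * P.pi1 * (|X 1| ^ (P.p - 1) * X 3)
      - P.αc * P.p * P.pi1 * (|X 2| ^ (P.p - 1) * f₃ P X) := by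
    funext X
    simp only [f₄, f₂, mul_assoc]
  rw [e]
  exact (h1.sub h2).sub h3

theorem locallyLipschitz_smul_const {E F : Type*} [PseudoEMetricSpace E] [NormedAddCommGroup F]
    [NormedSpace ℝ F] {g : E → ℝ} (hg : LocallyLipschitz g) (v : F) :
    LocallyLipschitz fun x => g x • v :=
  (contDiff_id.smul contDiff_const : ContDiff ℝ 1 fun r : ℝ => r • v).locallyLipschitz.comp hg

theorem locallyLipschitz_stateFun (hP : P.Admissible) : LocallyLipschitz (stateFun P) := by
  have e : stateFun P = fun X => f₁ P X • EuclideanSpace.single (0 : Fin 4) (1 : ℝ)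
      + f₂ X • EuclideanSpace.single (1 : Fin 4) (1 : ℝ)
      + f₃ P X • EuclideanSpace.single (2 : Fin 4) (1 : ℝ)
      + f₄ P X • EuclideanSpace.single (3 : Fin 4) (1 : ℝ) := by
    funext X
    ext i
    fin_cases i <;> simp [stateFun]
  rw [e]
  exact (((locallyLipschitz_smul_const (locallyLipschitz_f₁ hP) _).add
    (locallyLipschitz_smul_const (locallyLipschitz_coord 3) _)).add
    (locallyLipschitz_smul_const (locallyLipschitz_f₃ hP) _)).add
    (locallyLipschitz_smul_const (locallyLipschitz_f₄ hP) _)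

/-! ### The Lyapunov function: compact sublevel sets and the sign of its rate. -/

theorem continuous_Q (hP : P.Admissible) : Continuous (Q P) :=
  ((locallyLipschitz_f₁ hP).add (locallyLipschitz_coord 3)).continuous

theorem continuous_lyapunov (hP : P.Admissible) : Continuous (lyapunov P) := by
  have hQ := continuous_Q hP
  have hpow : Continuous fun x : ℝ => |x| ^ (P.p + 1) :=
    (locallyLipschitz_abs_rpow (by linarith [hP.one_le_p])).continuous
  have hc := fun i => (locallyLipschitz_coord i).continuous
  exact ((((hc 0).add (continuous_const.mul hQ)).pow 2).add ((hQ.pow 2).div_const 2)).add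
    (continuous_const.mul (hpow.comp (hc 1))) |>.add (continuous_const.mul (hpow.comp (hc 2)))

/-- Sublevel sets of the Lyapunov function are compact. -/
theorem isCompact_sublevel (hP : P.Admissible) (X₀ : EuclideanSpace ℝ (Fin 4)) :
    IsCompact (sublevel P X₀) := by
  have hp := hP.one_le_p
  have hα := hP.α_mem.1
  have hαc := hP.αc_pos
  have hπ := hP.pi1_pos
  have hA := hP.A_pos
  have hclosed : IsClosed (sublevel P X₀) :=
    isClosed_le (continuous_lyapunov hP) continuous_const
  set c := lyapunov P X₀ with hc
  set a := P.α / (P.p + 1) with ha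
  set b := P.αc / ((P.p + 1) * P.A) with hb
  have ha0 : 0 < a := by positivity
  have hb0 : 0 < b := by positivity
  -- All summands of `V` are nonnegative, so each is at most `c`. This bounds `Y`, `Z`, `Q` and `R +
  -- π₁Q` (squares via `|s| ≤ 1 + s²`); then `W = Q - f₁` and `R = (R + π₁Q) - π₁Q` are bounded too.
  set BY := 1 + c / a
  set BZ := 1 + c / b
  set BQ := 1 + 2 * c
  set BW := BQ + (P.α * P.pi1 * BY ^ P.p + P.αc * P.pi1 * BZ ^ P.p)
  set BR := 1 + c + P.pi1 * BQ
  have hbound : ∀ X ∈ sublevel P X₀, |X 0| ≤ BR ∧ |X 1| ≤ BY ∧ |X 2| ≤ BZ ∧ |X 3| ≤ BW := by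
    intro X hX
    have hX : (X 0 + P.pi1 * Q P X) ^ 2 + Q P X ^ 2 / 2 + a * |X 1| ^ (P.p + 1)
        + b * |X 2| ^ (P.p + 1) ≤ c := hX
    have h1 : 0 ≤ a * |X 1| ^ (P.p + 1) := by positivity
    have h2 : 0 ≤ b * |X 2| ^ (P.p + 1) := by positivity
    have h3 := sq_nonneg (X 0 + P.pi1 * Q P X)
    have h4 := sq_nonneg (Q P X)
    have hY : |X 1| ≤ BY := by
      have h : |X 1| ^ (P.p + 1) ≤ c / a := by rw [le_div_iff₀ ha0]; linarith
      linarith [abs_le_one_add_abs_rpow (by linarith : 1 ≤ P.p + 1) (X 1)]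
    have hZ : |X 2| ≤ BZ := by
      have h : |X 2| ^ (P.p + 1) ≤ c / b := by rw [le_div_iff₀ hb0]; linarith
      linarith [abs_le_one_add_abs_rpow (by linarith : 1 ≤ P.p + 1) (X 2)]
    have hQ : |Q P X| ≤ BQ := by
      rw [abs_le]; constructor <;> nlinarith
    have hf : |f₁ P X| ≤ P.α * P.pi1 * BY ^ P.p + P.αc * P.pi1 * BZ ^ P.p := by
      have e : f₁ P X = P.α * P.pi1 * (|X 1| ^ (P.p - 1) * X 1)
          + P.αc * P.pi1 * (|X 2| ^ (P.p - 1) * X 2) := by rw [f₁]; ring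
      rw [e]
      refine (abs_add_le _ _).trans ?_
      rw [abs_mul (P.α * P.pi1), abs_mul (P.αc * P.pi1), abs_abs_rpow_mul_self hp,
        abs_abs_rpow_mul_self hp, abs_of_pos (mul_pos hα hπ), abs_of_pos (mul_pos hαc hπ)]
      gcongr
    have hW : |X 3| ≤ BW := by
      have e : X 3 = Q P X - f₁ P X := by rw [Q, f₁]; ring
      rw [e]
      exact (abs_sub _ _).trans (add_le_add hQ hf)
    refine ⟨?_, hY, hZ, hW⟩
    have hS : |X 0 + P.pi1 * Q P X| ≤ 1 + c := by
      rw [abs_le]; constructor <;> nlinarith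
    have e : X 0 = (X 0 + P.pi1 * Q P X) - P.pi1 * Q P X := by ring
    rw [e]
    refine (abs_sub _ _).trans (add_le_add hS ?_)
    rw [abs_mul, abs_of_pos hπ]
    gcongr
  set B := max (max BR BY) (max BZ BW)
  have hK : IsCompact ((WithLp.toLp 2 : (Fin 4 → ℝ) → EuclideanSpace ℝ (Fin 4)) ''
      Icc (fun _ => -B) (fun _ => B)) :=
    isCompact_Icc.image (PiLp.continuous_toLp 2 _)
  refine hK.of_isClosed_subset hclosed fun X hX => ⟨WithLp.ofLp X, ?_, rfl⟩
  obtain ⟨h0, h1, h2, h3⟩ := hbound X hX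
  have hall : ∀ i, |X i| ≤ B := by
    intro i
    fin_cases i
    · exact h0.trans ((le_max_left _ _).trans (le_max_left _ _))
    · exact h1.trans ((le_max_right _ _).trans (le_max_left _ _))
    · exact h2.trans ((le_max_left _ _).trans (le_max_right _ _))
    · exact h3.trans ((le_max_right _ _).trans (le_max_right _ _))
  exact ⟨fun i => (abs_le.1 (hall i)).1, fun i => (abs_le.1 (hall i)).2⟩

/-- The derivative of the Lyapunov function along solutions. -/
noncomputable def lyapunovRate (P : Params) (X : EuclideanSpace ℝ (Fin 4)) : ℝ :=
  -(f₁ P X ^ 2 / P.pi1) - P.αc * (|X 2| ^ (P.p - 1) * |X 2| ^ (P.n - 1)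
    * (P.pi2 * X 2 ^ 2 * |X 3| + P.pi3 * |X 2| * X 2 * X 3))

/-- Hysteretic dissipation: since `|π₃| < π₂` for admissible parameters, the left side is
nonnegative and vanishes only if `z = 0` or `w = 0`. -/
theorem dissipation_lower_bound (P : Params) (z w : ℝ) :
    (P.pi2 - |P.pi3|) * (z ^ 2 * |w|) ≤ P.pi2 * z ^ 2 * |w| + P.pi3 * |z| * z * w := by
  have h : |P.pi3 * |z| * z * w| = |P.pi3| * (z ^ 2 * |w|) := by
    rw [abs_mul, abs_mul, abs_mul, abs_abs, ← sq_abs z]; ring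
  have := neg_abs_le (P.pi3 * |z| * z * w)
  rw [h] at this
  linarith

theorem Params.Admissible.abs_pi3_lt (hP : P.Admissible) : |P.pi3| < P.pi2 :=
  abs_lt.2 hP.pi3_mem

theorem lyapunovRate_nonpos (hP : P.Admissible) (X : EuclideanSpace ℝ (Fin 4)) :
    lyapunovRate P X ≤ 0 := by
  have hπ := hP.pi1_pos
  have hαc := hP.αc_pos
  have h := dissipation_lower_bound P (X 2) (X 3)
  have h' : 0 ≤ (P.pi2 - |P.pi3|) * (X 2 ^ 2 * |X 3|) :=
    mul_nonneg (sub_pos.2 hP.abs_pi3_lt).le (by positivity)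
  have h1 : 0 ≤ f₁ P X ^ 2 / P.pi1 := by positivity
  have h2 : 0 ≤ P.αc * (|X 2| ^ (P.p - 1) * |X 2| ^ (P.n - 1)
      * (P.pi2 * X 2 ^ 2 * |X 3| + P.pi3 * |X 2| * X 2 * X 3)) :=
    mul_nonneg hαc.le (mul_nonneg (by positivity) (h'.trans h))
  rw [lyapunovRate]
  linarith

theorem eq_zero_of_lyapunovRate_eq_zero (hP : P.Admissible) {X : EuclideanSpace ℝ (Fin 4)}
    (hX : lyapunovRate P X = 0) : f₁ P X = 0 ∧ (X 2 = 0 ∨ X 3 = 0) := by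
  have hπ := hP.pi1_pos
  have hαc := hP.αc_pos
  have h := dissipation_lower_bound P (X 2) (X 3)
  have hd := sub_pos.2 hP.abs_pi3_lt
  have h' : 0 ≤ (P.pi2 - |P.pi3|) * (X 2 ^ 2 * |X 3|) := mul_nonneg hd.le (by positivity)
  have h1 : 0 ≤ f₁ P X ^ 2 / P.pi1 := by positivity
  have h2 : 0 ≤ P.αc * (|X 2| ^ (P.p - 1) * |X 2| ^ (P.n - 1)
      * (P.pi2 * X 2 ^ 2 * |X 3| + P.pi3 * |X 2| * X 2 * X 3)) :=
    mul_nonneg hαc.le (mul_nonneg (by positivity) (h'.trans h))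
  rw [lyapunovRate] at hX
  constructor
  · have : f₁ P X ^ 2 / P.pi1 = 0 := by linarith
    simpa [hπ.ne'] using this
  · by_contra! hne
    have hz := abs_pos.2 hne.1
    have hw := abs_pos.2 hne.2
    have hpos : 0 < P.αc * (|X 2| ^ (P.p - 1) * |X 2| ^ (P.n - 1)
        * (P.pi2 * X 2 ^ 2 * |X 3| + P.pi3 * |X 2| * X 2 * X 3)) := by
      refine mul_pos hαc (mul_pos (by positivity) (lt_of_lt_of_le ?_ h))
      have := hne.1
      positivity
    linarith

/-! ### Derivatives along solutions and states of constant Lyapunov value. -/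

variable {x : ℝ → EuclideanSpace ℝ (Fin 4)}

theorem IsSolutionOn.hasDerivWithinAt_coord (hx : IsSolutionOn (stateFun P) (Ici 0) x)
    {t : ℝ} (ht : 0 ≤ t) (i : Fin 4) :
    HasDerivWithinAt (fun s => x s i) (stateFun P (x t) i) (Ici 0) t :=
  (EuclideanSpace.proj (𝕜 := ℝ) i).hasFDerivAt.comp_hasDerivWithinAt t (hx t ht)

/-- The last two terms of `f₄` are exactly minus the time derivative of `f₁`, so they cancel in `Q =
f₁ + W`. -/
theorem IsSolutionOn.hasDerivWithinAt_Q (hP : P.Admissible)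
    (hx : IsSolutionOn (stateFun P) (Ici 0) x) {t : ℝ} (ht : 0 ≤ t) :
    HasDerivWithinAt (fun s => Q P (x s)) (-(1 / P.pi1) * f₁ P (x t)) (Ici 0) t := by
  have hd := hasDerivAt_abs_rpow_mul_self hP.one_le_p
  have hY : HasDerivWithinAt (fun s => x s 1) (x t 3) (Ici 0) t := hx.hasDerivWithinAt_coord ht 1
  have hZ : HasDerivWithinAt (fun s => x s 2) (f₃ P (x t)) (Ici 0) t :=
    hx.hasDerivWithinAt_coord ht 2
  have hW : HasDerivWithinAt (fun s => x s 3) (f₄ P (x t)) (Ici 0) t :=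
    hx.hasDerivWithinAt_coord ht 3
  have h := ((((hd (x t 1)).comp_hasDerivWithinAt t hY).const_mul (P.α * P.pi1)).add
    (((hd (x t 2)).comp_hasDerivWithinAt t hZ).const_mul (P.αc * P.pi1))).add hW
  refine (h.congr (fun s _ => ?_) ?_).congr_deriv ?_
  · simp only [Q, Pi.add_apply, Function.comp_apply]; ring
  · simp only [Q, Pi.add_apply, Function.comp_apply]; ring
  · simp only [f₄, f₂]; ring

/-- The first square is constant in time. In `Q Q' = -(f₁ + W) f₁ / π₁` the cross term `-W f₁ / π₁`
cancels the power of the elastic energies, leaving `-f₁²/π₁` and the hysteresis term. -/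
theorem IsSolutionOn.hasDerivWithinAt_lyapunov (hP : P.Admissible)
    (hx : IsSolutionOn (stateFun P) (Ici 0) x) {t : ℝ} (ht : 0 ≤ t) :
    HasDerivWithinAt (fun s => lyapunov P (x s)) (lyapunovRate P (x t)) (Ici 0) t := by
  have hπ := hP.pi1_pos.ne'
  have hA := hP.A_pos.ne'
  have hp := hP.one_le_p
  have hp1 : P.p + 1 ≠ 0 := by linarith
  have hd := fun z : ℝ => hasDerivAt_abs_rpow z (by linarith : 1 < P.p + 1)
  have hR : HasDerivWithinAt (fun s => x s 0) (f₁ P (x t)) (Ici 0) t :=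
    hx.hasDerivWithinAt_coord ht 0
  have hY : HasDerivWithinAt (fun s => x s 1) (x t 3) (Ici 0) t := hx.hasDerivWithinAt_coord ht 1
  have hZ : HasDerivWithinAt (fun s => x s 2) (f₃ P (x t)) (Ici 0) t :=
    hx.hasDerivWithinAt_coord ht 2
  have hQ := hx.hasDerivWithinAt_Q hP ht
  have h := ((((hR.add (hQ.const_mul P.pi1)).pow 2).add ((hQ.pow 2).div_const 2)).add
    (((hd (x t 1)).comp_hasDerivWithinAt t hY).const_mul (P.α / (P.p + 1)))).add
    (((hd (x t 2)).comp_hasDerivWithinAt t hZ).const_mul (P.αc / ((P.p + 1) * P.A)))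
  refine h.congr_deriv ?_
  have e2 : P.p + 1 - 2 = P.p - 1 := by ring
  have hf : f₁ P (x t) = P.α * P.pi1 * |x t 1| ^ (P.p - 1) * x t 1
    + P.αc * P.pi1 * |x t 2| ^ (P.p - 1) * x t 2 := rfl
  have hQf : Q P (x t) = f₁ P (x t) + x t 3 := rfl
  rw [e2, lyapunovRate, f₃, ← abs_rpow_mul_abs hP.one_le_n (x t 2)]
  simp only [hQf, Pi.add_apply]
  generalize hF : f₁ P (x t) = F at *
  -- With `F` kept as an atom, the `Y`-force is eliminated in favour of `F` and the `Z`-force; what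
  -- remains is a polynomial identity.
  have hα : P.α * (|x t 1| ^ (P.p - 1) * x t 1)
      = F / P.pi1 - P.αc * (|x t 2| ^ (P.p - 1) * x t 2) := by
    rw [hf]; field_simp; ring
  have e3 : P.α / (P.p + 1) * ((P.p + 1) * |x t 1| ^ (P.p - 1) * x t 1 * x t 3)
      = P.α * (|x t 1| ^ (P.p - 1) * x t 1) * x t 3 := by field_simp
  rw [e3, hα]
  field_simp
  ring

theorem IsSolutionOn.antitoneOn_lyapunov (hP : P.Admissible)
    (hx : IsSolutionOn (stateFun P) (Ici 0) x) :
    AntitoneOn (fun t => lyapunov P (x t)) (Ici 0) := by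
  refine antitoneOn_of_hasDerivWithinAt_nonpos (f' := fun t => lyapunovRate P (x t))
    (convex_Ici 0) (fun t ht => (hx.hasDerivWithinAt_lyapunov hP ht).continuousWithinAt)
    (fun t ht => ?_) (fun t _ => lyapunovRate_nonpos hP _)
  exact (hx.hasDerivWithinAt_lyapunov hP (interior_subset ht)).mono interior_subset

theorem IsSolutionOn.mem_sublevel (hP : P.Admissible)
    (hx : IsSolutionOn (stateFun P) (Ici 0) x) {t : ℝ} (ht : 0 ≤ t) :
    x t ∈ sublevel P (x 0) :=
  hx.antitoneOn_lyapunov hP self_mem_Ici ht ht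

/-- With `φ(x) = |x| ^ (p - 1) * x`, the hypothesis reads `α φ(Y) + α_c φ(Z) = 0`. Since `φ` is odd,
injective and homogeneous of degree `p`, it can be solved for `Z`. -/
theorem spring_balance (hP : P.Admissible) {X : EuclideanSpace ℝ (Fin 4)} (h : f₁ P X = 0) :
    X 2 = -(P.α / P.αc) ^ (1 / P.p) * X 1 := by
  have hα := hP.α_mem.1
  have hαc := hP.αc_pos
  have hπ := hP.pi1_pos
  have hp := hP.one_le_p
  have hr : 0 < (P.α / P.αc) ^ (1 / P.p) := Real.rpow_pos_of_pos (div_pos hα hαc) _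
  refine abs_rpow_mul_self_injective hp ?_
  have hpow : ((P.α / P.αc) ^ (1 / P.p)) ^ (P.p - 1) * (P.α / P.αc) ^ (1 / P.p)
      = P.α / P.αc := by
    rw [← Real.rpow_add_one hr.ne', sub_add_cancel, ← Real.rpow_mul (div_pos hα hαc).le,
      one_div_mul_cancel (by linarith), Real.rpow_one]
  have hf : P.pi1 * (P.α * (|X 1| ^ (P.p - 1) * X 1) + P.αc * (|X 2| ^ (P.p - 1) * X 2)) = 0 := by
    rw [← h, f₁]; ring
  have hf := (mul_eq_zero.1 hf).resolve_left hπ.ne'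
  change |X 2| ^ (P.p - 1) * X 2 = |(-(P.α / P.αc) ^ (1 / P.p) * X 1)| ^ (P.p - 1)
    * (-(P.α / P.αc) ^ (1 / P.p) * X 1)
  rw [abs_mul, abs_neg, abs_of_pos hr, Real.mul_rpow hr.le (abs_nonneg _)]
  calc |X 2| ^ (P.p - 1) * X 2 = -(P.α / P.αc * (|X 1| ^ (P.p - 1) * X 1)) := by
        field_simp; linarith
    _ = -(((P.α / P.αc) ^ (1 / P.p)) ^ (P.p - 1) * (P.α / P.αc) ^ (1 / P.p)
          * (|X 1| ^ (P.p - 1) * X 1)) := by rw [hpow]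
    _ = _ := by ring

theorem mem_equilibria_of_lyapunov_const (hP : P.Admissible)
    (hx : IsSolutionOn (stateFun P) (Ici 0) x) {c : ℝ}
    (hc : ∀ t, 0 ≤ t → lyapunov P (x t) = c) : x 0 ∈ equilibria P := by
  have hrate : ∀ t, 0 ≤ t → lyapunovRate P (x t) = 0 := fun t ht =>
    (uniqueDiffOn_Ici (0 : ℝ) t ht).eq_deriv _ (hx.hasDerivWithinAt_lyapunov hP ht)
      ((hasDerivWithinAt_const t (Ici (0 : ℝ)) c).congr (fun s hs => hc s hs) (hc t ht))
  have hz := fun t ht => eq_zero_of_lyapunovRate_eq_zero hP (hrate t ht)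
  have hYZ := fun t ht => spring_balance hP (hz t ht).1
  have hW : x 0 3 = 0 := by
    by_contra hW
    have hY' : HasDerivWithinAt (fun s => x s 1) (x 0 3) (Ici 0) 0 :=
      hx.hasDerivWithinAt_coord le_rfl 1
    have hne : ∀ᶠ t in 𝓝[Ici 0] (0 : ℝ), x t 3 ≠ 0 :=
      ((hx.hasDerivWithinAt_coord le_rfl 3).continuousWithinAt).eventually_ne hW
    have hr : -(P.α / P.αc) ^ (1 / P.p) ≠ 0 :=
      neg_ne_zero.2 (Real.rpow_pos_of_pos (div_pos hP.α_mem.1 hP.αc_pos) _).ne'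
    -- While `W ≠ 0`, zero dissipation forces `Z = 0` and the spring balance then forces `Y = 0`. As
    -- `W` stays nonzero near time `0`, `Y` has right derivative `0` there, although that derivative
    -- is `W`.
    have hY0 : ∀ t, 0 ≤ t → x t 3 ≠ 0 → x t 1 = 0 := fun t ht h3 => by
      have := hYZ t ht
      rw [(hz t ht).2.resolve_right h3] at this
      exact (mul_eq_zero.1 this.symm).resolve_left hr
    refine hW ((uniqueDiffOn_Ici (0 : ℝ) 0 self_mem_Ici).eq_deriv _ hY'
      ((hasDerivWithinAt_const (0 : ℝ) (Ici (0 : ℝ)) (0 : ℝ)).congr_of_eventuallyEq ?_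
        (hY0 0 le_rfl hW)))
    filter_upwards [hne, self_mem_nhdsWithin] with t ht ht0
    exact hY0 t ht0 ht
  refine ⟨x 0 0, x 0 1, ?_⟩
  ext i
  fin_cases i
  · rfl
  · rfl
  · exact hYZ 0 le_rfl
  · exact hW

end Model

end BoucWenMaxwell

open BoucWenMaxwell

theorem mainTheorem4 (P : BoucWenMaxwell.Params) (hP : P.Admissible)
    (X : ℝ → EuclideanSpace ℝ (Fin 4)) (Y : EuclideanSpace ℝ (Fin 4))
    (hX : BoucWenMaxwell.IsSolutionOn (BoucWenMaxwell.stateFun P) (Set.Ici 0) X)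
    (hY : X 0 = Y) :
    (BoucWenMaxwell.positiveLimitSet (BoucWenMaxwell.stateFun P) Y).Nonempty ∧
    IsConnected (BoucWenMaxwell.positiveLimitSet (BoucWenMaxwell.stateFun P) Y) ∧
    BoucWenMaxwell.IsInvariant (BoucWenMaxwell.stateFun P)
      (BoucWenMaxwell.positiveLimitSet (BoucWenMaxwell.stateFun P) Y) ∧
    BoucWenMaxwell.ConvergesToSet X
      (BoucWenMaxwell.positiveLimitSet (BoucWenMaxwell.stateFun P) Y) ∧
    BoucWenMaxwell.positiveLimitSet (BoucWenMaxwell.stateFun P) Y ⊆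
      BoucWenMaxwell.sublevel P Y ∩ BoucWenMaxwell.equilibria P := by
  subst hY
  have hf := locallyLipschitz_stateFun hP
  have hK := isCompact_sublevel hP (X 0)
  have hXK : ∀ t, 0 ≤ t → X t ∈ sublevel P (X 0) := fun t ht => hX.mem_sublevel hP ht
  have hconn := isConnected_positiveLimitSet hf hX hK hXK
  refine ⟨hconn.nonempty, hconn, isInvariant_positiveLimitSet hf hX hK hXK,
    convergesToSet_positiveLimitSet hf hX hK hXK, fun q hq => ⟨?_, ?_⟩⟩
  · obtain ⟨t, ht, -, hq⟩ := (mem_positiveLimitSet_iff hf hX).1 hq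
    exact hK.isClosed.mem_of_tendsto hq (Eventually.of_forall fun k => hXK _ (ht k))
  · obtain ⟨y, hy, rfl, hc⟩ := exists_solution_lyapunov_const hf hX hK hXK
      (continuous_lyapunov hP) (hX.antitoneOn_lyapunov hP) hq
    exact mem_equilibria_of_lyapunov_const hP hy hc
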